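/- **Theorem 4.1.** For complex $a,q$ with $|q|<1$ let $(a;q)_\infty=\prod_{k\ge 0}(1-aq^k)$, and let $$G_1(q)=\frac{(q^2;q^2)_\infty^3}{(q;q)_\infty^2\,(q^{10};q^{10})_\infty}\qquad(|q|<1).$$ Let $g_1(n)$, $n\ge 0$, be the Taylor coefficients of $G_1$ at $q=0$. Then $G_1(q)=\sum_{n\ge 0}g_1(n)q^n$ for all complex $q$ with $|q|<1$, and $$g_1(n)\sim 3^{3/4}\,5^{1/4}\,(24n-6)^{-3/4}\exp\left(\frac{\pi}{2\sqrt{15}}\sqrt{24n-6}\right)\qquad (n\to\infty),$$ that is, the quotient of the two sides tends to $1$. -/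

import Mathlib

open Filter Asymptotics

noncomputable section

/-- The `q`-Pochhammer symbol `(a; q)_∞ = ∏_{k ≥ 0} (1 - a q^k)`. -/
def qPochhammer (a q : ℂ) : ℂ := ∏' k : ℕ, (1 - a * q ^ k)

/-- The eta-quotient `G₁(q) = (q²; q²)_∞³ / ((q; q)_∞² (q¹⁰; q¹⁰)_∞)`,
holomorphic on the open unit disk. -/
def G₁ (q : ℂ) : ℂ :=
  qPochhammer (q ^ 2) (q ^ 2) ^ 3 / (qPochhammer q q ^ 2 * qPochhammer (q ^ 10) (q ^ 10))

/-- The coefficient of `q ^ n` in the Taylor expansion of `G₁` at the origin. -/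
def g₁ (n : ℕ) : ℂ := iteratedDeriv n G₁ 0 / (n.factorial : ℂ)

end

open scoped Topology Real

/-- Euler's function `(q; q)_∞ = ∏_{n ≥ 1} (1 - q ^ n)`. -/
noncomputable def eulerFun (q : ℂ) : ℂ := ∏' n : ℕ, (1 - q ^ (n + 1))

theorem qPochhammer_self (q : ℂ) : qPochhammer q q = eulerFun q := by
  simp only [qPochhammer, eulerFun, pow_succ']

theorem G₁_eq (q : ℂ) :
    G₁ q = eulerFun (q ^ 2) ^ 3 / (eulerFun q ^ 2 * eulerFun (q ^ 10)) := by
  simp only [G₁, qPochhammer_self]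

theorem norm_pow_lt_one {q : ℂ} (hq : ‖q‖ < 1) {k : ℕ} (hk : k ≠ 0) : ‖q ^ k‖ < 1 := by
  rw [norm_pow]; exact pow_lt_one₀ (norm_nonneg q) hq hk

theorem one_sub_pow_ne_zero {q : ℂ} (hq : ‖q‖ < 1) {k : ℕ} (hk : k ≠ 0) : 1 - q ^ k ≠ 0 := by
  intro h
  have := norm_pow_lt_one hq hk
  rw [← sub_eq_zero.1 h] at this
  simp at this

theorem eulerFun_ne_zero {q : ℂ} (hq : ‖q‖ < 1) : eulerFun q ≠ 0 := by
  have hs : Summable fun n : ℕ ↦ ‖-q ^ (n + 1)‖ := by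
    simpa using (summable_nat_add_iff (f := fun n : ℕ ↦ ‖q‖ ^ n) 1).mpr
      (summable_geometric_of_lt_one (norm_nonneg _) hq)
  have h := tprod_one_add_ne_zero_of_summable (f := fun n : ℕ ↦ -q ^ (n + 1))
    (fun i ↦ by simpa [← sub_eq_add_neg] using one_sub_pow_ne_zero hq i.succ_ne_zero) hs
  simpa [eulerFun, sub_eq_add_neg] using h

theorem eulerFun_zero : eulerFun 0 = 1 := by simp [eulerFun]

theorem differentiableOn_eulerFun : DifferentiableOn ℂ eulerFun (Metric.ball 0 1) :=
  ModularForm.differentiableOn_tprod_one_sub_pow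

theorem differentiableAt_eulerFun {q : ℂ} (hq : ‖q‖ < 1) : DifferentiableAt ℂ eulerFun q :=
  differentiableOn_eulerFun.differentiableAt (Metric.isOpen_ball.mem_nhds (by simpa using hq))

theorem differentiableOn_G₁ : DifferentiableOn ℂ G₁ (Metric.ball 0 1) := by
  intro q hq
  have hq' : ‖q‖ < 1 := by simpa using hq
  have h : ∀ k : ℕ, k ≠ 0 → DifferentiableAt ℂ (fun x : ℂ ↦ eulerFun (x ^ k)) q := fun k hk ↦
    (differentiableAt_eulerFun (norm_pow_lt_one hq' hk)).comp q (differentiableAt_pow k)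
  rw [funext G₁_eq]
  exact (((h 2 two_ne_zero).pow 3).div (((differentiableAt_eulerFun hq').pow 2).mul
    (h 10 (by norm_num))) (mul_ne_zero (pow_ne_zero 2 (eulerFun_ne_zero hq'))
    (eulerFun_ne_zero (norm_pow_lt_one hq' (by norm_num))))).differentiableWithinAt

theorem tendsto_eulerFun {q : ℂ} (hq : ‖q‖ < 1) :
    Tendsto (fun N : ℕ ↦ ∏ k ∈ Finset.range N, (1 - q ^ (k + 1))) atTop (𝓝 (eulerFun q)) :=
  (ModularForm.multipliable_one_sub_pow hq).hasProd.tendsto_prod_nat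

theorem norm_eulerFun_norm_le {q : ℂ} (hq : ‖q‖ < 1) :
    ‖eulerFun (‖q‖ : ℝ)‖ ≤ ‖eulerFun q‖ := by
  have hq' : ‖((‖q‖ : ℝ) : ℂ)‖ < 1 := by simpa using hq
  refine le_of_tendsto_of_tendsto' (tendsto_eulerFun hq').norm (tendsto_eulerFun hq).norm
    fun N ↦ ?_
  rw [norm_prod, norm_prod]
  refine Finset.prod_le_prod (fun _ _ ↦ norm_nonneg _) fun k _ ↦ ?_
  have h1 : ‖q‖ ^ (k + 1) ≤ 1 := pow_le_one₀ (norm_nonneg _) hq.le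
  have h2 : ‖(1 : ℂ) - ((‖q‖ : ℝ) : ℂ) ^ (k + 1)‖ = 1 - ‖q‖ ^ (k + 1) := by
    rw [← Complex.ofReal_pow, ← Complex.ofReal_one, ← Complex.ofReal_sub, Complex.norm_real,
      Real.norm_of_nonneg (by linarith)]
  rw [h2]
  have h3 := norm_sub_norm_le (1 : ℂ) (q ^ (k + 1))
  simpa using h3

/-- The finite products in Shanks' identity. -/
noncomputable def shanksProd (q : ℂ) (n : ℕ) : ℂ :=
  ∏ j ∈ Finset.range n, ((1 - q ^ (2 * j + 2)) / (1 - q ^ (2 * j + 1)))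

theorem shanksProd_succ (q : ℂ) (n : ℕ) : shanksProd q (n + 1) =
    shanksProd q n * ((1 - q ^ (2 * n + 2)) / (1 - q ^ (2 * n + 1))) :=
  Finset.prod_range_succ _ n

theorem shanksProd_ne_zero {q : ℂ} (hq : ‖q‖ < 1) (n : ℕ) : shanksProd q n ≠ 0 :=
  Finset.prod_ne_zero_iff.2 fun j _ ↦ div_ne_zero (one_sub_pow_ne_zero hq (by omega))
    (one_sub_pow_ne_zero hq (by omega))

/-- **Shanks' identity**, a finite form of Gauss's triangular number theorem. -/
theorem sum_shanksProd {q : ℂ} (hq : ‖q‖ < 1) (n : ℕ) :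
    ∑ s ∈ Finset.range n, shanksProd q n / shanksProd q s * q ^ (s * (2 * n + 1)) =
      ∑ s ∈ Finset.range (2 * n), q ^ (s * (s + 1) / 2) := by
  induction n with
  | zero => simp
  | succ n ih =>
    have hd : 1 - q ^ (2 * n + 1) ≠ 0 := one_sub_pow_ne_zero hq (by omega)
    let U : ℕ → ℂ := fun s ↦ shanksProd q n / shanksProd q s * (1 - q ^ (2 * s)) *
      q ^ (s * (2 * n + 1)) / (1 - q ^ (2 * n + 1))
    have hU : ∀ s, shanksProd q (n + 1) / shanksProd q s * q ^ (s * (2 * (n + 1) + 1)) =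
        shanksProd q n / shanksProd q s * q ^ (s * (2 * n + 1)) + (U (s + 1) - U s) := by
      intro s
      have h1 := shanksProd_ne_zero hq s
      have h2 : 1 - q ^ (2 * s + 1) ≠ 0 := one_sub_pow_ne_zero hq (by omega)
      have h3 : 1 - q ^ (2 * s + 2) ≠ 0 := one_sub_pow_ne_zero hq (by omega)
      have e1 : q ^ (s * (2 * (n + 1) + 1)) = q ^ (s * (2 * n + 1)) * q ^ (2 * s) := by
        rw [← pow_add]; congr 1; ring
      have e2 : q ^ ((s + 1) * (2 * n + 1)) = q ^ (s * (2 * n + 1)) * q ^ (2 * n + 1) := by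
        rw [← pow_add]; congr 1; ring
      have e3 : q ^ (2 * (s + 1)) = q ^ (2 * s + 2) := by congr 1
      simp only [U, shanksProd_succ, e1, e2, e3]
      field_simp
      ring
    have hU0 : U 0 = 0 := by simp [U]
    have hUn : U n = 1 * (1 - q ^ (2 * n)) * q ^ (n * (2 * n + 1)) / (1 - q ^ (2 * n + 1)) := by
      simp only [U]; rw [div_self (shanksProd_ne_zero hq n)]
    rw [Finset.sum_range_succ, Finset.sum_congr rfl fun s _ ↦ hU s, Finset.sum_add_distrib, ih,
      Finset.sum_range_sub, hU0, hUn, shanksProd_succ, show 2 * (n + 1) = 2 * n + 1 + 1 by ring,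
      Finset.sum_range_succ, Finset.sum_range_succ]
    have h1 := shanksProd_ne_zero hq n
    have e1 : 2 * n * (2 * n + 1) / 2 = n * (2 * n + 1) := by
      rw [mul_assoc, Nat.mul_div_cancel_left _ two_pos]
    have e2 : (2 * n + 1) * (2 * n + 1 + 1) / 2 = n * (2 * n + 1) + (2 * n + 1) := by
      rw [show (2 * n + 1) * (2 * n + 1 + 1) = 2 * (n * (2 * n + 1) + (2 * n + 1)) by ring,
        Nat.mul_div_cancel_left _ two_pos]
    have e3 : q ^ (n * (2 * n + 1 + 1 + 1)) = q ^ (n * (2 * n + 1)) * q ^ (2 * n) := by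
      rw [← pow_add]; congr 1; ring
    have e4 : q ^ (2 * n + 2) = q ^ (2 * n) * q ^ 2 := pow_add _ _ _
    have e5 : q ^ (2 * n + 1) = q ^ (2 * n) * q := pow_succ _ _
    rw [e1, e2, e3, e4, pow_add q (n * (2 * n + 1))]
    rw [e5] at hd ⊢
    field_simp
    ring

theorem tendsto_shanksProd {q : ℂ} (hq : ‖q‖ < 1) :
    Tendsto (shanksProd q) atTop (𝓝 (eulerFun (q ^ 2) ^ 2 / eulerFun q)) := by
  have h1 := (tendsto_eulerFun (norm_pow_lt_one hq two_ne_zero)).pow 2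
  have h2 := (tendsto_eulerFun hq).comp (tendsto_id.const_mul_atTop' (two_pos : 0 < 2))
  refine (h1.div h2 (eulerFun_ne_zero hq)).congr fun n ↦ ?_
  simp only [Pi.div_apply, Function.comp, id]
  induction n with
  | zero => simp [shanksProd]
  | succ n ih =>
    rw [shanksProd_succ, ← ih, show 2 * (n + 1) = 2 * n + 1 + 1 by ring, Finset.prod_range_succ,
      Finset.prod_range_succ, Finset.prod_range_succ]
    have a1 : 1 - q ^ (2 * n + 1) ≠ 0 := one_sub_pow_ne_zero hq (by omega)
    have a2 : 1 - q ^ (2 * n + 1 + 1) ≠ 0 := one_sub_pow_ne_zero hq (by omega)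
    have a3 : ∏ k ∈ Finset.range (2 * n), (1 - q ^ (k + 1)) ≠ 0 :=
      Finset.prod_ne_zero_iff.2 fun j _ ↦ one_sub_pow_ne_zero hq (by omega)
    rw [← pow_mul, show 2 * (n + 1) = 2 * n + 1 + 1 by ring,
      show 2 * n + 2 = 2 * n + 1 + 1 by ring]
    field_simp

/-- **Gauss's triangular number theorem**. -/
theorem tendsto_sum_pow_triangular {q : ℂ} (hq : ‖q‖ < 1) :
    Tendsto (fun n : ℕ ↦ ∑ s ∈ Finset.range (2 * n), q ^ (s * (s + 1) / 2)) atTop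
      (𝓝 (eulerFun (q ^ 2) ^ 2 / eulerFun q)) := by
  set ψ := eulerFun (q ^ 2) ^ 2 / eulerFun q with hψ
  have hψ0 : ψ ≠ 0 := div_ne_zero (pow_ne_zero 2 (eulerFun_ne_zero
    (norm_pow_lt_one hq two_ne_zero))) (eulerFun_ne_zero hq)
  have hlim := tendsto_shanksProd hq
  obtain ⟨B, hB⟩ := hlim.norm.bddAbove_range
  obtain ⟨C, hC⟩ := (hlim.inv₀ hψ0).norm.bddAbove_range
  have hB' : ∀ n, ‖shanksProd q n‖ ≤ B := fun n ↦ hB ⟨n, rfl⟩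
  have hC' : ∀ n, ‖(shanksProd q n)⁻¹‖ ≤ C := fun n ↦ hC ⟨n, rfl⟩
  have hB0 : 0 ≤ B := (norm_nonneg _).trans (hB' 0)
  have hC0 : 0 ≤ C := (norm_nonneg _).trans (hC' 0)
  have hz : Tendsto (fun n : ℕ ↦ B * C * (n * ‖q‖ ^ n)) atTop (𝓝 0) := by
    simpa using (tendsto_self_mul_const_pow_of_lt_one (norm_nonneg q) hq).const_mul (B * C)
  have hdiff : Tendsto (fun n : ℕ ↦ (∑ s ∈ Finset.range (2 * n), q ^ (s * (s + 1) / 2)) -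
      shanksProd q n) atTop (𝓝 0) := by
    refine squeeze_zero_norm' ?_ hz
    filter_upwards [eventually_ge_atTop 1] with n hn
    obtain ⟨m, rfl⟩ : ∃ m, n = m + 1 := ⟨n - 1, by omega⟩
    rw [← sum_shanksProd hq, Finset.sum_range_succ']
    simp only [shanksProd, Finset.range_zero, Finset.prod_empty, zero_mul, pow_zero, div_one,
      mul_one, add_sub_cancel_right]
    refine (norm_sum_le_of_le _ (n := fun _ ↦ B * C * ‖q‖ ^ (m + 1)) fun s _ ↦ ?_).trans ?_
    · rw [norm_mul, div_eq_mul_inv, norm_mul, norm_pow]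
      refine mul_le_mul (mul_le_mul (hB' _) (hC' _) (norm_nonneg _) hB0) ?_ (by positivity)
        (by positivity)
      exact pow_le_pow_of_le_one (norm_nonneg _) hq.le (by nlinarith)
    · rw [Finset.sum_const, Finset.card_range, nsmul_eq_mul]
      push_cast
      have : 0 ≤ B * C * ‖q‖ ^ (m + 1) := by positivity
      nlinarith
  simpa using hdiff.add hlim

theorem norm_gaussTheta_le {q : ℂ} (hq : ‖q‖ < 1) :
    ‖eulerFun (q ^ 2) ^ 2 / eulerFun q‖ ≤
      ‖eulerFun (((‖q‖ : ℝ) : ℂ) ^ 2) ^ 2 / eulerFun (‖q‖ : ℝ)‖ := by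
  have hq' : ‖((‖q‖ : ℝ) : ℂ)‖ < 1 := by simpa using hq
  refine le_of_tendsto_of_tendsto' (tendsto_sum_pow_triangular hq).norm
    (tendsto_sum_pow_triangular hq').norm fun n ↦ ?_
  refine (norm_sum_le _ _).trans ?_
  simp only [norm_pow]
  rw [← Complex.norm_of_nonneg (r := ∑ i ∈ Finset.range (2 * n), ‖q‖ ^ (i * (i + 1) / 2))
    (Finset.sum_nonneg fun _ _ ↦ by positivity)]
  push_cast
  rfl

theorem tendsto_prod_one_add_pow {q : ℂ} (hq : ‖q‖ < 1) :
    Tendsto (fun N : ℕ ↦ ∏ k ∈ Finset.range N, (1 + q ^ (k + 1))) atTop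
      (𝓝 (eulerFun (q ^ 2) / eulerFun q)) := by
  refine ((tendsto_eulerFun (norm_pow_lt_one hq two_ne_zero)).div (tendsto_eulerFun hq)
    (eulerFun_ne_zero hq)).congr fun N ↦ ?_
  simp only [Pi.div_apply]
  rw [← Finset.prod_div_distrib]
  refine Finset.prod_congr rfl fun k _ ↦ ?_
  rw [div_eq_iff (one_sub_pow_ne_zero hq (k.add_one_ne_zero))]
  ring

theorem norm_one_add_le_exp {w : ℂ} (hw : ‖w‖ ≤ 1) :
    ‖1 + w‖ ≤ (1 + ‖w‖) * Real.exp (-((‖w‖ - w.re) / 4)) := by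
  have h0 := Complex.re_le_norm w
  have hn := norm_nonneg w
  have h1 : ‖1 + w‖ ^ 2 = 1 + 2 * w.re + ‖w‖ ^ 2 := by
    rw [Complex.sq_norm, Complex.sq_norm, Complex.normSq_apply, Complex.normSq_apply]
    simp only [Complex.add_re, Complex.one_re, Complex.add_im, Complex.one_im]
    ring
  have h2 := Real.add_one_le_exp (-((‖w‖ - w.re) / 2))
  have h3 : Real.exp (-((‖w‖ - w.re) / 2)) = Real.exp (-((‖w‖ - w.re) / 4)) ^ 2 := by
    rw [← Real.exp_nat_mul]; congr 1; push_cast; ring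
  refine le_of_sq_le_sq ?_ (by positivity)
  rw [h1, mul_pow, ← h3]
  have h4 : (1 + ‖w‖) ^ 2 ≤ 4 := by nlinarith
  have h5 : (1 + ‖w‖) ^ 2 * (-((‖w‖ - w.re) / 2) + 1) ≤
    (1 + ‖w‖) ^ 2 * Real.exp (-((‖w‖ - w.re) / 2)) := by gcongr
  nlinarith

theorem norm_distinctProd_le {q : ℂ} (hq : ‖q‖ < 1) :
    ‖eulerFun (q ^ 2) / eulerFun q‖ ≤
      ‖eulerFun (((‖q‖ : ℝ) : ℂ) ^ 2) / eulerFun (‖q‖ : ℝ)‖ *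
        Real.exp (-((1 / (1 - ‖q‖) - (1 / (1 - q)).re) / 4)) := by
  have hq' : ‖((‖q‖ : ℝ) : ℂ)‖ < 1 := by simpa using hq
  have hs : Tendsto (fun N : ℕ ↦ ∑ k ∈ Finset.range (N + 1), (‖q‖ ^ k - (q ^ k).re)) atTop
      (𝓝 (1 / (1 - ‖q‖) - (1 / (1 - q)).re)) := by
    have h1 := (hasSum_geometric_of_lt_one (norm_nonneg q) hq).tendsto_sum_nat
    have h2 := (Complex.continuous_re.tendsto _).comp
      (hasSum_geometric_of_norm_lt_one hq).tendsto_sum_nat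
    have h3 := (h1.sub h2).comp (tendsto_add_atTop_nat 1)
    simpa [Function.comp_def] using h3
  have hs' := (Real.continuous_exp.tendsto _).comp (hs.div_const 4).neg
  refine le_of_tendsto_of_tendsto' (tendsto_prod_one_add_pow hq).norm
    ((tendsto_prod_one_add_pow hq').norm.mul hs') fun N ↦ ?_
  simp only [Function.comp]
  rw [Finset.sum_range_succ', norm_prod, norm_prod]
  simp only [pow_zero, Complex.one_re, sub_self, add_zero]
  rw [Finset.sum_div, ← Finset.sum_neg_distrib, Real.exp_sum, ← Finset.prod_mul_distrib]
  refine Finset.prod_le_prod (fun _ _ ↦ norm_nonneg _) fun k _ ↦ ?_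
  have h1 := norm_one_add_le_exp (w := q ^ (k + 1)) (norm_pow_lt_one hq k.succ_ne_zero).le
  have h2 : ‖(1 : ℂ) + ((‖q‖ : ℝ) : ℂ) ^ (k + 1)‖ = 1 + ‖q‖ ^ (k + 1) := by
    rw [← Complex.ofReal_pow, ← Complex.ofReal_one, ← Complex.ofReal_add, Complex.norm_real,
      Real.norm_of_nonneg (by positivity)]
  rw [h2]
  simpa only [norm_pow] using h1

theorem norm_G₁_le {q : ℂ} (hq : ‖q‖ < 1) :
    ‖G₁ q‖ ≤ ‖G₁ (‖q‖ : ℝ)‖ * Real.exp (-((1 / (1 - ‖q‖) - (1 / (1 - q)).re) / 4)) := by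
  have hfac : ∀ x : ℂ, G₁ x = (eulerFun (x ^ 2) ^ 2 / eulerFun x) *
      (eulerFun (x ^ 2) / eulerFun x) * (eulerFun (x ^ 10))⁻¹ := by
    intro x
    rw [G₁_eq, div_mul_div_comm, ← div_eq_mul_inv, div_div]
    ring_nf
  have h10 := norm_eulerFun_norm_le (norm_pow_lt_one hq (k := 10) (by norm_num))
  have hpos : 0 < ‖eulerFun ((‖q ^ 10‖ : ℝ) : ℂ)‖ :=
    norm_pos_iff.2 (eulerFun_ne_zero (by simpa using norm_pow_lt_one hq (k := 10) (by norm_num)))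
  have h3 : ‖(eulerFun (q ^ 10))⁻¹‖ ≤ ‖(eulerFun (((‖q‖ : ℝ) : ℂ) ^ 10))⁻¹‖ := by
    rw [norm_inv, norm_inv, ← Complex.ofReal_pow, ← norm_pow]
    exact inv_anti₀ hpos h10
  rw [hfac, hfac, norm_mul, norm_mul, norm_mul, norm_mul]
  calc _ ≤ _ := mul_le_mul (mul_le_mul (norm_gaussTheta_le hq) (norm_distinctProd_le hq)
        (norm_nonneg _) (norm_nonneg _)) h3 (norm_nonneg _) (by positivity)
    _ = _ := by ring

theorem mem_upperHalfPlaneSet_of_re_pos {z : ℂ} (hz : 0 < z.re) :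
    Complex.I * z / (2 * π) ∈ UpperHalfPlane.upperHalfPlaneSet := by
  have h : Complex.I * z / (2 * π) = Complex.I * z / ((2 * π : ℝ) : ℂ) := by push_cast; rfl
  rw [h]
  simp only [UpperHalfPlane.upperHalfPlaneSet, Set.mem_ofPred_eq, Complex.div_ofReal_im,
    Complex.I_mul_im]
  positivity

theorem eta_eq_exp_mul_eulerFun (z : ℂ) :
    ModularForm.eta (Complex.I * z / (2 * π)) =
      Complex.exp (-z / 24) * eulerFun (Complex.exp (-z)) := by
  have hpi : (π : ℂ) ≠ 0 := Complex.ofReal_ne_zero.2 Real.pi_ne_zero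
  have h : 2 * π * Complex.I * (Complex.I * z / (2 * π)) = -z := by
    field_simp
    rw [Complex.I_sq]; ring
  simp only [ModularForm.eta, eulerFun, ModularForm.eta_q_eq_pow, h]
  congr 1
  simp only [Function.Periodic.qParam, h]
  norm_num

/-- The constant in the inversion formula of Euler's function. -/
noncomputable def etaFactor (z : ℂ) : ℂ :=
  Complex.sqrt Complex.I / Complex.sqrt (Complex.I * z / (2 * π))

theorem csqrt_ne_zero {z : ℂ} (hz : z ≠ 0) : Complex.sqrt z ≠ 0 := by
  rw [sqrt_eq_exp hz]; exact Complex.exp_ne_zero _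

theorem etaFactor_ne_zero {z : ℂ} (hz : z ≠ 0) : etaFactor z ≠ 0 := by
  have hpi : (π : ℂ) ≠ 0 := Complex.ofReal_ne_zero.2 Real.pi_ne_zero
  exact div_ne_zero (csqrt_ne_zero Complex.I_ne_zero) (csqrt_ne_zero (by simp [hz]))

theorem sqrt_real_mul {j : ℝ} (hj : 0 < j) {w : ℂ} (hw : w ≠ 0) :
    Complex.sqrt (j * w) = (√j : ℝ) * Complex.sqrt w := by
  rw [sqrt_eq_exp hw, sqrt_eq_exp (mul_ne_zero (Complex.ofReal_ne_zero.2 hj.ne') hw),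
    Complex.log_ofReal_mul hj hw, add_div, Complex.exp_add]
  congr 1
  rw [show √j = Real.exp (Real.log j / 2) by rw [Real.exp_half, Real.exp_log hj]]
  push_cast
  rfl

theorem etaFactor_real_mul {j : ℝ} (hj : 0 < j) {z : ℂ} (hz : z ≠ 0) :
    etaFactor (j * z) = etaFactor z / (√j : ℝ) := by
  have hpi : (π : ℂ) ≠ 0 := Complex.ofReal_ne_zero.2 Real.pi_ne_zero
  have h : Complex.I * (j * z) / (2 * π) = j * (Complex.I * z / (2 * π)) := by ring
  rw [etaFactor, etaFactor, h, sqrt_real_mul hj (by simp [hz]), div_div, mul_comm (Complex.sqrt _)]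

/-- The modular inversion formula for Euler's function. -/
theorem eulerFun_exp_neg {z : ℂ} (hz : 0 < z.re) :
    eulerFun (Complex.exp (-z)) = etaFactor z * Complex.exp (z / 24) *
      Complex.exp (-(π ^ 2 / (6 * z))) * eulerFun (Complex.exp (-(4 * π ^ 2 / z))) := by
  have hpi : (π : ℂ) ≠ 0 := Complex.ofReal_ne_zero.2 Real.pi_ne_zero
  have hz0 : z ≠ 0 := by rintro rfl; simp at hz
  have h := ModularForm.eta_comp_eq_csqrt_I_inv (mem_upperHalfPlaneSet_of_re_pos hz)
  have h1 : -1 / (Complex.I * z / (2 * π)) = Complex.I * (4 * π ^ 2 / z) / (2 * π) := by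
    field_simp
    rw [Complex.I_sq]; ring
  simp only [Function.comp, Pi.smul_apply, Pi.mul_apply, smul_eq_mul, h1,
    eta_eq_exp_mul_eulerFun] at h
  have h2 : Complex.exp (-(4 * π ^ 2 / z) / 24) = Complex.exp (-(π ^ 2 / (6 * z))) := by
    congr 1; field_simp; norm_num
  have h3 : Complex.exp (z / 24) * Complex.exp (-(z / 24)) = 1 := by
    rw [← Complex.exp_add, ← Complex.exp_zero]; congr 1; ring
  have hI := csqrt_ne_zero Complex.I_ne_zero
  have hS : Complex.sqrt (Complex.I * z / (2 * π)) ≠ 0 := csqrt_ne_zero (by simp [hz0])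
  rw [h2] at h
  rw [mul_assoc _ (Complex.exp (-(π ^ 2 / (6 * z)))), h, etaFactor]
  generalize Complex.sqrt (Complex.I * z / (2 * π)) = S at hS
  field_simp
  linear_combination -eulerFun (Complex.exp (-z)) * h3

/-- The quotient of Euler functions at the inverted argument. -/
noncomputable def dualRatio (z : ℂ) : ℂ :=
  eulerFun (Complex.exp (-(2 * π ^ 2 / z))) ^ 3 / (eulerFun (Complex.exp (-(4 * π ^ 2 / z))) ^ 2 *
    eulerFun (Complex.exp (-(2 * π ^ 2 / (5 * z)))))

theorem G₁_exp_neg {z : ℂ} (hz : 0 < z.re) :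
    G₁ (Complex.exp (-z)) = (√5 / 2 : ℝ) * Complex.exp (π ^ 2 / 10 / z - z / 4) * dualRatio z := by
  have hz0 : z ≠ 0 := by rintro rfl; simp at hz
  have key : ∀ j : ℝ, 0 < j → eulerFun (Complex.exp (-(j * z))) = etaFactor z / (√j : ℝ) *
      Complex.exp (j * z / 24) * Complex.exp (-(π ^ 2 / (6 * (j * z)))) *
        eulerFun (Complex.exp (-(4 * π ^ 2 / (j * z)))) := fun j hj ↦ by
    rw [← etaFactor_real_mul hj hz0]
    exact eulerFun_exp_neg (by rw [Complex.re_ofReal_mul]; positivity)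
  have k2 := key 2 two_pos
  have k10 := key 10 (by norm_num)
  have p : ∀ k : ℕ, Complex.exp (-z) ^ k = Complex.exp (-(k * z)) := fun k ↦ by
    rw [← Complex.exp_nat_mul]; congr 1; ring
  have e2 : (4 * π ^ 2 / (((2 : ℝ) : ℂ) * z) : ℂ) = 2 * π ^ 2 / z := by
    push_cast; field_simp; norm_num
  have e10 : (4 * π ^ 2 / (((10 : ℝ) : ℂ) * z) : ℂ) = 2 * π ^ 2 / (5 * z) := by
    push_cast; field_simp; norm_num
  rw [e2] at k2
  rw [e10] at k10
  rw [G₁_eq, p, p]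
  rw [show (((2 : ℕ) : ℂ) * z) = ((2 : ℝ) : ℂ) * z by norm_num,
    show (((10 : ℕ) : ℂ) * z) = ((10 : ℝ) : ℂ) * z by norm_num, k2, k10, eulerFun_exp_neg hz,
    dualRatio]
  have hE := etaFactor_ne_zero hz0
  have hexp : Complex.exp (π ^ 2 / 10 / z - z / 4) =
      (Complex.exp (((2 : ℝ) : ℂ) * z / 24) * Complex.exp (-(π ^ 2 / (6 * (((2 : ℝ) : ℂ) * z))))) ^ 3 /
      ((Complex.exp (z / 24) * Complex.exp (-(π ^ 2 / (6 * z)))) ^ 2 *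
      (Complex.exp (((10 : ℝ) : ℂ) * z / 24) * Complex.exp (-(π ^ 2 / (6 * (((10 : ℝ) : ℂ) * z)))))) := by
    simp only [← Complex.exp_add, ← Complex.exp_nat_mul, ← Complex.exp_sub]
    congr 1
    push_cast
    field_simp
    ring
  have hsq : ((√5 / 2 : ℝ) : ℂ) = (√10 : ℝ) / ((√2 : ℝ) : ℂ) ^ 3 := by
    rw [← Complex.ofReal_pow, ← Complex.ofReal_div]
    congr 1
    rw [show (10 : ℝ) = 5 * 2 by norm_num, Real.sqrt_mul (by norm_num)]
    have := Real.sq_sqrt (show (0 : ℝ) ≤ 2 by norm_num)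
    have h2 : √(2 : ℝ) ≠ 0 := by positivity
    field_simp
    linarith
  have h2 : ((√2 : ℝ) : ℂ) ≠ 0 := Complex.ofReal_ne_zero.2 (by positivity)
  have h10 : ((√10 : ℝ) : ℂ) ≠ 0 := Complex.ofReal_ne_zero.2 (by positivity)
  rw [hexp, hsq]
  simp only [div_pow, mul_pow]
  field_simp

theorem tendsto_dualRatio {ι : Type*} {l : Filter ι} {f : ι → ℂ}
    (hf : Tendsto (fun i ↦ (f i)⁻¹.re) l atTop) :
    Tendsto (fun i ↦ dualRatio (f i)) l (𝓝 1) := by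
  have hcont : ContinuousAt eulerFun 0 := (differentiableAt_eulerFun (by simp)).continuousAt
  have key : ∀ c : ℝ, 0 < c →
      Tendsto (fun i ↦ eulerFun (Complex.exp (-(c / f i)))) l (𝓝 1) := fun c hc ↦ by
    have h0 : Tendsto (fun i ↦ Complex.exp (-(c / f i))) l (𝓝 0) := by
      rw [tendsto_zero_iff_norm_tendsto_zero]
      simp only [Complex.norm_exp]
      refine Real.tendsto_exp_atBot.comp ?_
      simp only [Complex.neg_re, div_eq_mul_inv, Complex.re_ofReal_mul]
      exact tendsto_neg_atTop_atBot.comp (hf.const_mul_atTop hc)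
    have := hcont.tendsto.comp h0
    rwa [eulerFun_zero] at this
  have h2 := key (2 * π ^ 2) (by positivity)
  have h4 := key (4 * π ^ 2) (by positivity)
  have h10 := key (2 * π ^ 2 / 5) (by positivity)
  have := (h2.pow 3).div ((h4.pow 2).mul h10) (by norm_num)
  refine (this.congr fun i ↦ ?_).trans (by norm_num)
  simp only [dualRatio, Pi.div_apply]
  push_cast
  rw [div_div (2 * (π : ℂ) ^ 2) 5]

theorem g₁_eq_integral (n : ℕ) {r : ℝ} (hr : 0 < r) (hr1 : r < 1) :
    g₁ n = (2 * π : ℂ)⁻¹ *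
      ∫ θ in (-π)..π, G₁ (circleMap 0 r θ) * ((circleMap 0 r θ) ^ n)⁻¹ := by
  have hc := (differentiableOn_G₁.mono
    (Metric.closedBall_subset_ball hr1)).circleIntegral_one_div_sub_center_pow_smul hr n
  have hI : ∀ θ : ℝ, deriv (circleMap 0 r) θ • (1 / (circleMap 0 r θ - 0) ^ (n + 1)) •
      G₁ (circleMap 0 r θ) =
      Complex.I * (G₁ (circleMap 0 r θ) * ((circleMap 0 r θ) ^ n)⁻¹) := by
    intro θ
    have h0 : circleMap 0 r θ ≠ 0 := circleMap_ne_center hr.ne'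
    simp only [deriv_circleMap, smul_eq_mul, sub_zero]
    field_simp
    ring
  rw [circleIntegral] at hc
  simp only [hI, intervalIntegral.integral_const_mul] at hc
  have hper : Function.Periodic
      (fun θ ↦ G₁ (circleMap 0 r θ) * ((circleMap 0 r θ) ^ n)⁻¹) (2 * π) := fun θ ↦ by
    simp only [periodic_circleMap 0 r θ]
  have hp := hper.intervalIntegral_add_eq 0 (-π)
  rw [zero_add, show -π + 2 * π = π by ring] at hp
  rw [hp, smul_eq_mul, mul_comm (2 * π : ℂ), mul_div_assoc, mul_assoc] at hc
  rw [mul_left_cancel₀ Complex.I_ne_zero hc, g₁]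
  have hpi : (π : ℂ) ≠ 0 := Complex.ofReal_ne_zero.2 Real.pi_ne_zero
  have hn : (n.factorial : ℂ) ≠ 0 := Nat.cast_ne_zero.2 n.factorial_ne_zero
  field_simp

/-- The integrand of the rescaled Cauchy integral. -/
noncomputable def saddleIntegrand (s u : ℝ) : ℂ :=
  dualRatio (s ^ 2 * (1 - s * u * Complex.I)) *
    Complex.exp (-(π ^ 2 / 10 * u ^ 2 / (1 - s * u * Complex.I)))

theorem one_sub_ofReal_mul_I_ne_zero (x y : ℝ) : (1 : ℂ) - x * y * Complex.I ≠ 0 := by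
  intro h
  simpa using congrArg Complex.re h

theorem G₁_mul_exp_eq {s : ℝ} (hs : 0 < s) (u : ℝ) {c : ℂ} (hc : c = π ^ 2 / 10 / s ^ 4 + 1 / 4) :
    G₁ (Complex.exp (-(s ^ 2 * (1 - s * u * Complex.I)))) *
      Complex.exp (c * (s ^ 2 * (1 - s * u * Complex.I))) =
    (√5 / 2 : ℝ) * Complex.exp (π ^ 2 / 5 / s ^ 2) * saddleIntegrand s u := by
  have hs0 : (s : ℂ) ≠ 0 := Complex.ofReal_ne_zero.2 hs.ne'
  have h1 := one_sub_ofReal_mul_I_ne_zero s u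
  have hre : ((s : ℂ) ^ 2 * (1 - s * u * Complex.I)).re = s ^ 2 := by
    rw [← Complex.ofReal_pow, Complex.re_ofReal_mul]; simp
  rw [G₁_exp_neg (by rw [hre]; positivity), saddleIntegrand]
  have he : Complex.exp (π ^ 2 / 10 / (s ^ 2 * (1 - s * u * Complex.I)) -
      (s ^ 2 * (1 - s * u * Complex.I)) / 4) *
      Complex.exp (c * (s ^ 2 * (1 - s * u * Complex.I))) = Complex.exp (π ^ 2 / 5 / s ^ 2) *
      Complex.exp (-(π ^ 2 / 10 * u ^ 2 / (1 - s * u * Complex.I))) := by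
    rw [← Complex.exp_add, ← Complex.exp_add]
    congr 1
    rw [hc]
    field_simp
    ring_nf
    rw [Complex.I_sq]
    ring
  linear_combination (√5 / 2 : ℝ) * dualRatio (s ^ 2 * (1 - s * u * Complex.I)) * he

theorem g₁_eq_saddle (n : ℕ) {s : ℝ} (hs : 0 < s) (hn : (n : ℝ) = π ^ 2 / 10 / s ^ 4 + 1 / 4) :
    g₁ n = (2 * π : ℂ)⁻¹ * s ^ 3 * (√5 / 2 : ℝ) * Complex.exp (π ^ 2 / 5 / s ^ 2) *
      ∫ u in (-(π / s ^ 3))..(π / s ^ 3), saddleIntegrand s u := by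
  have hs0 : (s : ℂ) ≠ 0 := Complex.ofReal_ne_zero.2 hs.ne'
  rw [g₁_eq_integral n (Real.exp_pos (-s ^ 2)) (by rw [Real.exp_lt_one_iff]; nlinarith)]
  have h := intervalIntegral.integral_comp_mul_left (a := -(π / s ^ 3)) (b := π / s ^ 3)
    (fun θ ↦ G₁ (circleMap 0 (Real.exp (-s ^ 2)) θ) *
      ((circleMap 0 (Real.exp (-s ^ 2)) θ) ^ n)⁻¹) (pow_ne_zero 3 hs.ne')
  have e1 : s ^ 3 * (π / s ^ 3) = π := by field_simp
  rw [mul_neg, e1] at h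
  have h2 : ∀ u : ℝ, G₁ (circleMap 0 (Real.exp (-s ^ 2)) (s ^ 3 * u)) *
      ((circleMap 0 (Real.exp (-s ^ 2)) (s ^ 3 * u)) ^ n)⁻¹ =
      (√5 / 2 : ℝ) * Complex.exp (π ^ 2 / 5 / s ^ 2) * saddleIntegrand s u := by
    intro u
    rw [← G₁_mul_exp_eq hs u (c := (n : ℂ)) (by
      have := congrArg Complex.ofReal hn
      push_cast at this
      exact this)]
    have e2 : circleMap 0 (Real.exp (-s ^ 2)) (s ^ 3 * u) =
        Complex.exp (-(s ^ 2 * (1 - s * u * Complex.I))) := by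
      rw [circleMap, zero_add, Complex.ofReal_exp, ← Complex.exp_add]
      congr 1
      push_cast
      ring
    rw [e2, ← Complex.exp_nat_mul, ← Complex.exp_neg]
    congr 2
    ring
  simp only [h2, intervalIntegral.integral_const_mul] at h
  rw [eq_comm, inv_smul_eq_iff₀ (pow_ne_zero 3 hs.ne')] at h
  rw [h, Complex.real_smul]
  push_cast
  ring

theorem re_gain_ge {t θ : ℝ} (ht : 0 < t) (ht2 : t ≤ 1 / 2) (hθ : |θ| ≤ π) :
    θ ^ 2 / (t * (π ^ 2 * t ^ 2 + 2 * θ ^ 2)) ≤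
      1 / (1 - Real.exp (-t)) - (1 / (1 - Complex.exp (-t + θ * Complex.I))).re := by
  have hcos := Real.cos_le_one_sub_mul_cos_sq hθ
  have hpi := Real.pi_pos
  set r := Real.exp (-t) with hr
  have hr1 : 1 - t ≤ r := by linarith [Real.add_one_le_exp (-t)]
  have hr2 : r < 1 := by rw [hr, Real.exp_lt_one_iff]; linarith
  have hq : Complex.exp (-t + θ * Complex.I) =
      (r * Real.cos θ : ℝ) + (r * Real.sin θ : ℝ) * Complex.I := by
    rw [Complex.exp_add, Complex.exp_mul_I, hr]; push_cast; ring
  have hre : (1 / (1 - Complex.exp (-t + θ * Complex.I))).re =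
      (1 - r * Real.cos θ) / ((1 - r * Real.cos θ) ^ 2 + (r * Real.sin θ) ^ 2) := by
    rw [hq, one_div, Complex.inv_re, Complex.normSq_apply]
    simp only [Complex.sub_re, Complex.one_re, Complex.add_re, Complex.ofReal_re, Complex.mul_re,
      Complex.I_re, mul_zero, Complex.ofReal_im, Complex.I_im, mul_one, sub_self, add_zero,
      Complex.sub_im, Complex.one_im, Complex.add_im, Complex.mul_im, zero_add, zero_sub]
    congr 1
    ring
  obtain ⟨a, ha⟩ : ∃ a, a = 1 - r := ⟨_, rfl⟩
  obtain ⟨w, hw⟩ : ∃ w, w = r * (1 - Real.cos θ) := ⟨_, rfl⟩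
  have hden : (1 - r * Real.cos θ) ^ 2 + (r * Real.sin θ) ^ 2 = a ^ 2 + 2 * w := by
    have := Real.sin_sq_add_cos_sq θ
    rw [ha, hw]
    linear_combination r ^ 2 * this
  have hnum : 1 - r * Real.cos θ = a + w := by rw [ha, hw]; ring
  have ha0 : 0 < a := by linarith
  have hat : a ≤ t := by linarith
  have hw0 : θ ^ 2 / π ^ 2 ≤ w := by
    have h1 : 2 / π ^ 2 * θ ^ 2 ≤ 1 - Real.cos θ := by linarith
    have h2 : (1 / 2) * (2 / π ^ 2 * θ ^ 2) ≤ r * (1 - Real.cos θ) := by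
      refine mul_le_mul (by linarith) h1 (by positivity) (by linarith)
    rw [hw]
    calc _ = (1 / 2) * (2 / π ^ 2 * θ ^ 2) := by ring
      _ ≤ _ := h2
  have hv0 : 0 ≤ θ ^ 2 / π ^ 2 := by positivity
  have hw1 : 0 ≤ w := hv0.trans hw0
  rw [hre, hden, hnum]
  calc θ ^ 2 / (t * (π ^ 2 * t ^ 2 + 2 * θ ^ 2))
      = (θ ^ 2 / π ^ 2) / (t * (t ^ 2 + 2 * (θ ^ 2 / π ^ 2))) := by field_simp
    _ ≤ w / (t * (t ^ 2 + 2 * w)) := by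
        rw [div_le_div_iff₀ (by positivity) (by positivity)]
        have : 0 ≤ t ^ 3 * (w - θ ^ 2 / π ^ 2) := mul_nonneg (by positivity) (by linarith)
        nlinarith
    _ ≤ w / (a * (a ^ 2 + 2 * w)) := by gcongr
    _ ≤ w * (2 - a) / (a * (a ^ 2 + 2 * w)) := by
        gcongr
        nlinarith
    _ = 1 / a - (a + w) / (a ^ 2 + 2 * w) := by
        have : a ^ 2 + 2 * w ≠ 0 := by positivity
        field_simp
        ring
    _ = _ := by rw [ha]

theorem exp_neg_gain_le {s u x : ℝ} (hs : 0 < s) (hu : |u| ≤ π / s ^ 3)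
    (hx : u ^ 2 / (π ^ 2 + 2 * s ^ 2 * u ^ 2) ≤ x) :
    Real.exp (-(x / 4)) ≤ 55296 * π ^ 2 * (1 + u ^ 2)⁻¹ := by
  have hpi := Real.pi_pos
  have hpi3 := Real.pi_gt_three
  have hx0 : 0 ≤ x := le_trans (by positivity) hx
  have h1 : π ^ 2 + u ^ 2 ≤ (1 + x) * (π ^ 2 + 2 * s ^ 2 * u ^ 2) := by
    rw [div_le_iff₀ (by positivity)] at hx
    nlinarith [sq_nonneg (s * u)]
  have h2 : s ^ 6 * u ^ 2 ≤ π ^ 2 := by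
    rw [le_div_iff₀ (by positivity)] at hu
    have := pow_le_pow_left₀ (by positivity) hu 2
    rw [mul_pow, sq_abs] at this
    linarith [this, show u ^ 2 * (s ^ 3) ^ 2 = s ^ 6 * u ^ 2 by ring]
  obtain ⟨y, hy⟩ : ∃ y, y = u ^ 2 := ⟨_, rfl⟩
  have hy0 : 0 ≤ y := hy ▸ sq_nonneg u
  rw [← hy] at h1 h2 ⊢
  obtain ⟨p, hp⟩ : ∃ p, p = π ^ 2 := ⟨_, rfl⟩
  have hp0 : 9 < p := by rw [hp]; nlinarith
  rw [← hp] at h1 h2 ⊢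
  have h3 : (p + y) ^ 3 ≤ (1 + x) ^ 3 * (p + 2 * s ^ 2 * y) ^ 3 := by
    rw [← mul_pow]; exact pow_le_pow_left₀ (by positivity) h1 3
  have h4 : (p + 2 * s ^ 2 * y) ^ 3 ≤ 32 * p * (p + y) ^ 2 := by
    have hc : ∀ b : ℝ, 0 ≤ b → (p + b) ^ 3 ≤ 4 * (p ^ 3 + b ^ 3) := fun b hb ↦ by
      nlinarith [mul_nonneg (add_nonneg (by linarith : (0 : ℝ) ≤ p) hb) (sq_nonneg (p - b))]
    refine (hc _ (by positivity)).trans ?_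
    have : (2 * s ^ 2 * y) ^ 3 = 8 * (s ^ 6 * y) * y ^ 2 := by ring
    rw [this]
    have h5 : 8 * (s ^ 6 * y) * y ^ 2 ≤ 8 * p * y ^ 2 := by gcongr
    have : 0 ≤ p * p * y := by positivity
    have : 0 ≤ p * p * p := by positivity
    nlinarith
  have h5 : p + y ≤ (1 + x) ^ 3 * (32 * p) := by
    have h6 : (p + y) ^ 2 * (p + y) ≤ (p + y) ^ 2 * ((1 + x) ^ 3 * (32 * p)) := by
      calc (p + y) ^ 2 * (p + y) = (p + y) ^ 3 := by ring
        _ ≤ (1 + x) ^ 3 * (32 * p * (p + y) ^ 2) :=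
          h3.trans (mul_le_mul_of_nonneg_left h4 (by positivity))
        _ = _ := by ring
    exact le_of_mul_le_mul_left h6 (by positivity)
  have h6 : ((1 + x) / 12) ^ 3 ≤ Real.exp (x / 4) := by
    have : Real.exp (x / 4) = Real.exp (x / 12) ^ 3 := by
      rw [← Real.exp_nat_mul]; congr 1; push_cast; ring
    rw [this]
    exact pow_le_pow_left₀ (by positivity) (by linarith [Real.add_one_le_exp (x / 12)]) 3
  have h7 : (1 + x) ^ 3 ≤ 1728 * Real.exp (x / 4) := by
    rw [div_pow] at h6
    linarith
  rw [Real.exp_neg, ← div_eq_mul_inv, le_div_iff₀ (by positivity), ← div_eq_inv_mul,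
    div_le_iff₀ (Real.exp_pos _)]
  have h8 : (1 + x) ^ 3 * (32 * p) ≤ 1728 * Real.exp (x / 4) * (32 * p) := by gcongr
  linarith

theorem norm_saddleIntegrand_le {s u : ℝ} (hs : 0 < s) (hs2 : s ^ 2 ≤ 1 / 2)
    (hu : |u| ≤ π / s ^ 3) :
    ‖saddleIntegrand s u‖ ≤ ‖saddleIntegrand s 0‖ * (55296 * π ^ 2 * (1 + u ^ 2)⁻¹) := by
  have hθ : |s ^ 3 * u| ≤ π := by
    rw [abs_mul, abs_of_pos (by positivity : 0 < s ^ 3)]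
    rw [le_div_iff₀ (by positivity)] at hu
    linarith
  have hg := re_gain_ge (by positivity : 0 < s ^ 2) hs2 hθ
  have hg' : (s ^ 3 * u) ^ 2 / (s ^ 2 * (π ^ 2 * (s ^ 2) ^ 2 + 2 * (s ^ 3 * u) ^ 2)) =
      u ^ 2 / (π ^ 2 + 2 * s ^ 2 * u ^ 2) := by
    have : π ^ 2 + 2 * s ^ 2 * u ^ 2 ≠ 0 := by positivity
    field_simp
  rw [hg'] at hg
  have hE := exp_neg_gain_le hs hu hg
  have hq : (-(s ^ 2 * (1 - s * u * Complex.I)) : ℂ) =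
      -((s ^ 2 : ℝ) : ℂ) + ((s ^ 3 * u : ℝ) : ℂ) * Complex.I := by push_cast; ring
  have hnorm : ‖Complex.exp (-(s ^ 2 * (1 - s * u * Complex.I)))‖ = Real.exp (-s ^ 2) := by
    rw [hq, Complex.norm_exp, Complex.add_re, Complex.neg_re, Complex.ofReal_re,
      Complex.re_ofReal_mul, Complex.I_re, mul_zero, add_zero]
  have hG := norm_G₁_le (q := Complex.exp (-(s ^ 2 * (1 - s * u * Complex.I))))
    (by rw [hnorm, Real.exp_lt_one_iff]; nlinarith)
  rw [hnorm] at hG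
  obtain ⟨c, hc⟩ : ∃ c : ℝ, c = π ^ 2 / 10 / s ^ 4 + 1 / 4 := ⟨_, rfl⟩
  have hc' : (c : ℂ) = π ^ 2 / 10 / s ^ 4 + 1 / 4 := by rw [hc]; push_cast; rfl
  have hre : ∀ v : ℝ, ‖Complex.exp (c * (s ^ 2 * (1 - s * v * Complex.I)))‖ =
      Real.exp (c * s ^ 2) := fun v ↦ by
    rw [Complex.norm_exp, Complex.re_ofReal_mul, ← Complex.ofReal_pow, Complex.re_ofReal_mul,
      ← Complex.ofReal_mul]
    simp
  have hA := congrArg norm (G₁_mul_exp_eq hs u hc')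
  have hB := congrArg norm (G₁_mul_exp_eq hs 0 hc')
  rw [norm_mul, norm_mul, hre] at hA hB
  have hz : Complex.exp (-(s ^ 2 * (1 - s * (0 : ℝ) * Complex.I))) =
      (Real.exp (-s ^ 2) : ℝ) := by
    rw [Complex.ofReal_exp]; congr 1; push_cast; ring
  rw [hz] at hB
  have hK : 0 < ‖((√5 / 2 : ℝ) : ℂ) * Complex.exp (π ^ 2 / 5 / s ^ 2)‖ := by
    refine norm_pos_iff.2 (mul_ne_zero (Complex.ofReal_ne_zero.2 (by positivity))
      (Complex.exp_ne_zero _))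
  refine le_of_mul_le_mul_left ?_ hK
  rw [← hA, ← mul_assoc, ← hB]
  have hE0 := Real.exp_pos (c * s ^ 2)
  rw [hq] at hG ⊢
  calc _ ≤ ‖G₁ (Real.exp (-s ^ 2) : ℝ)‖ * (55296 * π ^ 2 * (1 + u ^ 2)⁻¹) *
        Real.exp (c * s ^ 2) :=
        mul_le_mul_of_nonneg_right (hG.trans
          (mul_le_mul_of_nonneg_left hE (norm_nonneg _))) hE0.le
    _ = _ := by ring

theorem continuous_saddleIntegrand {s : ℝ} (hs : 0 < s) : Continuous (saddleIntegrand s) := by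
  have hs0 : (s : ℂ) ≠ 0 := Complex.ofReal_ne_zero.2 hs.ne'
  have hK : ((√5 / 2 : ℝ) : ℂ) * Complex.exp (π ^ 2 / 5 / s ^ 2) ≠ 0 :=
    mul_ne_zero (Complex.ofReal_ne_zero.2 (by positivity)) (Complex.exp_ne_zero _)
  have h : saddleIntegrand s = fun u : ℝ ↦
      (((√5 / 2 : ℝ) : ℂ) * Complex.exp (π ^ 2 / 5 / s ^ 2))⁻¹ *
      (G₁ (Complex.exp (-(s ^ 2 * (1 - s * u * Complex.I)))) *
        Complex.exp ((π ^ 2 / 10 / s ^ 4 + 1 / 4) * (s ^ 2 * (1 - s * u * Complex.I)))) := by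
    funext u
    rw [G₁_mul_exp_eq hs u rfl, inv_mul_cancel_left₀ hK]
  rw [h]
  have hG : Continuous fun u : ℝ ↦ G₁ (Complex.exp (-(s ^ 2 * (1 - s * u * Complex.I)))) := by
    refine differentiableOn_G₁.continuousOn.comp_continuous (by fun_prop) fun u ↦ ?_
    have hre : (-((s : ℂ) ^ 2 * (1 - s * u * Complex.I))).re < 0 := by
      rw [← Complex.ofReal_pow, Complex.neg_re, Complex.re_ofReal_mul, ← Complex.ofReal_mul]
      simpa using pow_pos hs 2
    rw [mem_ball_zero_iff, Complex.norm_exp, Real.exp_lt_one_iff]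
    exact hre
  fun_prop

theorem tendsto_saddleIntegrand (u : ℝ) :
    Tendsto (fun s ↦ saddleIntegrand s u) (𝓝[>] 0)
      (𝓝 ((Real.exp (-(π ^ 2 / 10) * u ^ 2) : ℝ) : ℂ)) := by
  have hw : Tendsto (fun s : ℝ ↦ (1 : ℂ) - s * u * Complex.I) (𝓝[>] 0) (𝓝 1) := by
    have h : Continuous fun s : ℝ ↦ (1 : ℂ) - s * u * Complex.I := by fun_prop
    simpa using (h.tendsto 0).mono_left nhdsWithin_le_nhds
  have hinv := hw.inv₀ one_ne_zero
  have hre : Tendsto (fun s : ℝ ↦ ((1 : ℂ) - s * u * Complex.I)⁻¹.re) (𝓝[>] 0) (𝓝 1) := by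
    simpa only [inv_one, Complex.one_re, Function.comp_def] using
      (Complex.continuous_re.tendsto _).comp hinv
  have hs : Tendsto (fun s : ℝ ↦ (s ^ 2)⁻¹) (𝓝[>] 0) atTop := by
    simpa only [inv_pow, Function.comp_def] using
      (tendsto_pow_atTop two_ne_zero).comp (tendsto_inv_nhdsGT_zero (𝕜 := ℝ))
  have h1 := tendsto_dualRatio (f := fun s : ℝ ↦ (s : ℂ) ^ 2 * (1 - s * u * Complex.I))
    ((hs.atTop_mul_pos one_pos hre).congr fun s ↦ by
      rw [mul_inv, ← Complex.ofReal_pow, ← Complex.ofReal_inv, Complex.re_ofReal_mul])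
  have h2 := (Complex.continuous_exp.tendsto _).comp
    ((hinv.const_mul ((π : ℂ) ^ 2 / 10 * u ^ 2)).neg)
  refine ((h1.mul h2).congr fun s ↦ ?_).trans ?_
  · simp only [saddleIntegrand, Function.comp, div_eq_mul_inv]
  · push_cast
    simp

theorem tendsto_integral_saddleIntegrand :
    Tendsto (fun s : ℝ ↦ ∫ u in (-(π / s ^ 3))..(π / s ^ 3), saddleIntegrand s u) (𝓝[>] 0)
      (𝓝 ((√(10 / π) : ℝ) : ℂ)) := by
  have hpi := Real.pi_pos
  have hpos : ∀ᶠ s : ℝ in 𝓝[>] 0, 0 < s := self_mem_nhdsWithin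
  have hlim : ((√(10 / π) : ℝ) : ℂ) =
      ∫ u : ℝ, ((Real.exp (-(π ^ 2 / 10) * u ^ 2) : ℝ) : ℂ) := by
    rw [integral_complex_ofReal, integral_gaussian]
    congr 2
    field_simp
  have hcongr : (fun s : ℝ ↦ ∫ u in (-(π / s ^ 3))..(π / s ^ 3), saddleIntegrand s u) =ᶠ[𝓝[>] 0]
      fun s ↦ ∫ u, (Set.Ioc (-(π / s ^ 3)) (π / s ^ 3)).indicator (saddleIntegrand s) u := by
    filter_upwards [hpos] with s hs
    rw [MeasureTheory.integral_indicator measurableSet_Ioc, intervalIntegral.integral_of_le]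
    have : 0 < π / s ^ 3 := by positivity
    linarith
  rw [hlim]
  refine Tendsto.congr' hcongr.symm ?_
  refine MeasureTheory.tendsto_integral_filter_of_dominated_convergence
    (fun u ↦ 2 * (55296 * π ^ 2 * (1 + u ^ 2)⁻¹)) ?_ ?_ ?_ ?_
  · filter_upwards [hpos] with s hs
    exact (continuous_saddleIntegrand hs).aestronglyMeasurable.indicator measurableSet_Ioc
  · have h0 : ∀ᶠ s : ℝ in 𝓝[>] 0, ‖saddleIntegrand s 0‖ < 2 := by
      have := (tendsto_saddleIntegrand 0).norm
      refine this.eventually (gt_mem_nhds ?_)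
      simp
    have h1 : ∀ᶠ s : ℝ in 𝓝[>] 0, s ^ 2 < 1 / 2 := by
      have : Tendsto (fun s : ℝ ↦ s ^ 2) (𝓝[>] 0) (𝓝 0) := by
        simpa using ((continuous_pow 2).tendsto (0 : ℝ)).mono_left nhdsWithin_le_nhds
      exact this.eventually (gt_mem_nhds (by norm_num))
    filter_upwards [hpos, h0, h1] with s hs h0 h1
    refine Eventually.of_forall fun u ↦ ?_
    by_cases hu : u ∈ Set.Ioc (-(π / s ^ 3)) (π / s ^ 3)
    · rw [Set.indicator_of_mem hu]
      refine (norm_saddleIntegrand_le hs h1.le (abs_le.2 ⟨hu.1.le, hu.2⟩)).trans ?_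
      gcongr
    · rw [Set.indicator_of_notMem hu, norm_zero]
      positivity
  · exact (integrable_inv_one_add_sq.const_mul _).const_mul _
  · refine Eventually.of_forall fun u ↦ (tendsto_saddleIntegrand u).congr' ?_
    have hT : Tendsto (fun s : ℝ ↦ π / s ^ 3) (𝓝[>] 0) atTop := by
      simpa only [inv_pow, Function.comp_def, div_eq_mul_inv] using
        ((tendsto_pow_atTop three_ne_zero).comp
          (tendsto_inv_nhdsGT_zero (𝕜 := ℝ))).const_mul_atTop hpi
    filter_upwards [hT.eventually_gt_atTop |u|] with s hs
    rw [Set.indicator_of_mem]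
    exact ⟨(abs_lt.1 hs).1, (abs_lt.1 hs).2.le⟩

theorem sqrt_pow_four {y : ℝ} (hy : 0 ≤ y) : √y ^ 4 = y ^ 2 := by
  calc √y ^ 4 = (√y ^ 2) ^ 2 := by ring
    _ = y ^ 2 := by rw [Real.sq_sqrt hy]

/-- The main term of `g₁` in terms of the saddle point `s ^ 2`. -/
theorem main_term_eq {x s : ℝ} (hx : 0 < x) (hs : 0 < s) (hsx : s ^ 4 = 12 * π ^ 2 / (5 * x)) :
    (3 : ℝ) ^ (3 / 4 : ℝ) * (5 : ℝ) ^ (1 / 4 : ℝ) * x ^ (-(3 / 4) : ℝ) *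
        Real.exp (π / (2 * √15) * √x) =
      (2 * π)⁻¹ * s ^ 3 * (√5 / 2) * Real.exp (π ^ 2 / 5 / s ^ 2) * √(10 / π) := by
  have hpi := Real.pi_pos
  have h1 : π / (2 * √15) * √x = π ^ 2 / 5 / s ^ 2 := by
    refine (sq_eq_sq₀ (by positivity) (by positivity)).1 ?_
    rw [mul_pow, div_pow, div_pow, mul_pow, Real.sq_sqrt (by norm_num), Real.sq_sqrt hx.le,
      ← pow_mul, hsx]
    field_simp
    norm_num
  have h2 : (3 : ℝ) ^ (3 / 4 : ℝ) * (5 : ℝ) ^ (1 / 4 : ℝ) * x ^ (-(3 / 4) : ℝ) =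
      (2 * π)⁻¹ * s ^ 3 * (√5 / 2) * √(10 / π) := by
    refine (pow_left_inj₀ (by positivity) (by positivity) four_ne_zero).1 ?_
    have e1 : ((3 : ℝ) ^ (3 / 4 : ℝ)) ^ 4 = 27 := by
      rw [← Real.rpow_mul_natCast (by norm_num)]; norm_num
    have e2 : ((5 : ℝ) ^ (1 / 4 : ℝ)) ^ 4 = 5 := by
      rw [← Real.rpow_mul_natCast (by norm_num)]; norm_num
    have e3 : (x ^ (-(3 / 4) : ℝ)) ^ 4 = (x ^ 3)⁻¹ := by
      rw [← Real.rpow_mul_natCast hx.le, show (-(3 / 4) * ((4 : ℕ) : ℝ) : ℝ) = -((3 : ℕ) : ℝ) by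
        norm_num, Real.rpow_neg hx.le, Real.rpow_natCast]
    have e4 : (s ^ 3) ^ 4 = (12 * π ^ 2 / (5 * x)) ^ 3 := by rw [← hsx]; ring
    have e5 : √5 ^ 4 = 25 := by
      rw [sqrt_pow_four (by norm_num)]; norm_num
    have e6 : √(10 / π) ^ 4 = (10 / π) ^ 2 := sqrt_pow_four (by positivity)
    rw [mul_pow, mul_pow, mul_pow, mul_pow, mul_pow, div_pow, e1, e2, e3, e4, e5, e6]
    field_simp
    norm_num
  rw [h1, h2]
  ring

theorem hasSum_g₁ {q : ℂ} (hq : ‖q‖ < 1) : HasSum (fun n : ℕ ↦ g₁ n * q ^ n) (G₁ q) := by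
  have h := Complex.hasSum_taylorSeries_on_ball differentiableOn_G₁
    (show q ∈ Metric.ball (0 : ℂ) 1 by simpa using hq)
  have e : (fun n : ℕ ↦ g₁ n * q ^ n) =
      fun n ↦ (n.factorial : ℂ)⁻¹ • (q - 0) ^ n • iteratedDeriv n G₁ 0 := by
    funext n
    simp only [g₁, sub_zero, smul_eq_mul]
    ring
  rw [e]
  exact h

theorem theorem4p1 :
    (∀ q : ℂ, ‖q‖ < 1 → HasSum (fun n : ℕ => g₁ n * q ^ n) (G₁ q)) ∧
    g₁ ~[atTop] fun n : ℕ =>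
      (((3 : ℝ) ^ (3 / 4 : ℝ) * (5 : ℝ) ^ (1 / 4 : ℝ) * (24 * (n : ℝ) - 6) ^ (-(3 / 4) : ℝ) *
        Real.exp (Real.pi / (2 * Real.sqrt 15) * Real.sqrt (24 * (n : ℝ) - 6)) : ℝ) : ℂ) := by
  refine ⟨fun q hq ↦ hasSum_g₁ hq, ?_⟩
  have hpi := Real.pi_pos
  let s : ℕ → ℝ := fun n ↦ √√(12 * π ^ 2 / (5 * (24 * (n : ℝ) - 6)))
  have hx : ∀ n : ℕ, 1 ≤ n → 0 < 24 * (n : ℝ) - 6 := fun n hn ↦ by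
    have : (1 : ℝ) ≤ n := by exact_mod_cast hn
    linarith
  have hs0 : ∀ n, 1 ≤ n → 0 < s n := fun n hn ↦ by
    have := hx n hn
    positivity
  have hs4 : ∀ n, 1 ≤ n → s n ^ 4 = 12 * π ^ 2 / (5 * (24 * (n : ℝ) - 6)) := fun n hn ↦ by
    have := hx n hn
    rw [sqrt_pow_four (Real.sqrt_nonneg _), Real.sq_sqrt (by positivity)]
  have hslim : Tendsto s atTop (𝓝[>] 0) := by
    refine tendsto_nhdsWithin_iff.2 ⟨?_, (eventually_ge_atTop 1).mono hs0⟩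
    have h1 : Tendsto (fun n : ℕ ↦ 5 * (24 * (n : ℝ) - 6)) atTop atTop :=
      (tendsto_atTop_add_const_right _ (-6)
        (tendsto_natCast_atTop_atTop.const_mul_atTop (by norm_num))).const_mul_atTop (by norm_num)
    have h2 := (Real.continuous_sqrt.comp Real.continuous_sqrt).tendsto 0
    simpa [s, Function.comp_def] using h2.comp (h1.const_div_atTop (12 * π ^ 2))
  have hJ := (tendsto_integral_saddleIntegrand.comp hslim).div_const ((√(10 / π) : ℝ) : ℂ)
  have hc0 : ((√(10 / π) : ℝ) : ℂ) ≠ 0 := Complex.ofReal_ne_zero.2 (by positivity)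
  rw [div_self hc0] at hJ
  refine isEquivalent_of_tendsto_one (hJ.congr' ?_)
  filter_upwards [eventually_ge_atTop 1] with n hn
  have hsn := hs0 n hn
  have hxn := hx n hn
  have hn' : (n : ℝ) = π ^ 2 / 10 / s n ^ 4 + 1 / 4 := by
    rw [hs4 n hn]
    field_simp
    ring
  rw [Pi.div_apply, g₁_eq_saddle n hsn hn', main_term_eq hxn hsn (hs4 n hn)]
  have hs' : (s n : ℂ) ≠ 0 := Complex.ofReal_ne_zero.2 hsn.ne'
  have hpi' : (π : ℂ) ≠ 0 := Complex.ofReal_ne_zero.2 hpi.ne'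
  have h5 : ((√5 : ℝ) : ℂ) ≠ 0 := Complex.ofReal_ne_zero.2 (by positivity)
  have hexp := Complex.exp_ne_zero (π ^ 2 / 5 / (s n : ℂ) ^ 2)
  simp only [Function.comp]
  push_cast
  field_simp
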